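/- Let $\mathcal M=(S,s_0,A,P,R,\gamma,\mathrm{AP},L)$ be a finite labeled MDP in which every set $A(s)$ of allowed actions is non-empty. Here $L:S\to 2^{\mathrm{AP}}$ is the labeling and $P(s,a,\cdot)$ is a probability distribution on $S$ if $a\in A(s)$ and is zero otherwise. Let $\mathcal A_\psi=(Q_\psi,q_{0\psi},\delta_\psi,B_\psi)$ be a safety automaton over the alphabet $2^{\mathrm{AP}}$: it is finite, its transition function $\delta_\psi$ is deterministic, and all states outside $B_\psi$ are absorbing. Let $\mathcal A_\varphi=(Q_\varphi,q_{0\varphi},\delta_\varphi,B_\varphi)$ be a finite limit-deterministic Büchi automaton: $\delta_\varphi:Q_\varphi\times(2^{\mathrm{AP}}\cup\{\varepsilon\})\to 2^{Q_\varphi}$, every $\delta_\varphi(q,\theta)$ with $\theta\in2^{\mathrm{AP}}$ is a singleton, and there is a set $Q_A\supseteq B_\varphi$ such that $Q_A$ has no $\varepsilon$-transitions, cannot be left, and contains the target of every $\varepsilon$-transition. The product MDP $\mathcal M^\times$ has state set $S^\times=S\times Q_\psi\times Q_\varphi$. The allowed actions are $A^\times(s,q,p)=A(s)\cup\{\varepsilon_{p'}: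 p'\in\delta_\varphi(p,\varepsilon)\}$. An action $a\in A(s)$ leads from $(s,q,p)$ with probability $P(s,a,s')$ to $(s',q',p')$, where $q'=\delta_\psi(q,L(s))$ and $\{p'\}=\delta_\varphi(p,L(s))$. The action $\varepsilon_{p'}$ leads to $(s,q,p')$ with probability $1$. Put $B^\times_\psi=S\times B_\psi\times Q_\varphi$ and $B^\times_\varphi=S\times Q_\psi\times B_\varphi$. A path satisfies $\square B$ if it stays in $B$ forever, and $\square\lozenge B$ if it visits $B$ infinitely often. For a memoryless (possibly mixed) policy $\pi$, a path condition $\phi$, a state $x$ and an action $a$, let $\Pr_\pi(x\models\phi)$ be the probability that the random path started in $x$ under $\pi$ satisfies $\phi$, and let $$\Pr\nolimits_{\max}((x,a)\models\phi)=\max_\pi\sum_{x'}P^\times(x,a,x')\Pr\nolimits_\pi(x'\models\phi),$$ where $\pi$ ranges over the memoryless policies. Let $$A^\times_\psi(x)=\operatorname*{argmax}_{a\in A^\times(x)}\Pr\nolimits_{\max}((x,a)\models\square B^\times_\psi).$$ In the MDP obtained from $\mathcal M^\times$ by pruning, in each state $x'$, all the actions not in $A^\times_\psi(x')$, let $$A^\times_{\psi,\varphi}(x)=\operatorname*{argmax}_{a\in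 A^\times_\psi(x)}\Pr\nolimits_{\max}((x,a)\models\square\lozenge B^\times_\varphi),$$ where the maximum probabilities are those of the pruned MDP. For $r>0$ let $R_r(x)=r$ and $\Gamma_r(x)=1-r$ if $x\in B^\times_\varphi$, and $R_r(x)=0$ and $\Gamma_r(x)=1-r^2$ if $x\notin B^\times_\varphi$. The return of a path $\rho$ is $$G_r(\rho)=\sum_{t=0}^\infty\Big(\prod_{i=0}^t\Gamma_r(\rho[i])\Big)R_r(\rho[t]).$$ Let $$q_r(x,a)=\max_\pi\sum_{x'}P^\times(x,a,x')\,\mathbb E_{\pi,x'}[G_r]$$ be the maximum expected return after taking $a$ in $x$ in the pruned MDP, where $\pi$ ranges over the memoryless policies of the pruned MDP and $\mathbb E_{\pi,x'}$ is the expectation over the path started in $x'$ under $\pi$. Let $v_r(x)=\max_{a\in A^\times_\psi(x)}q_r(x,a)$. Then for all sufficiently small $\tau_\varphi>0$ and all sufficiently small $r_\varphi>0$ (how small may depend on $\tau_\varphi$), for all $x\in S^\times$, $$A^\times_{\psi,\varphi}(x)=\{a\in A^\times_\psi(x) : v_{r_\varphi}(x)-q_{r_\varphi}(x,a)\le\tau_\varphi\}.$$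 That is, there is $\tau_0>0$ such that for every $\tau_\varphi\in(0,\tau_0)$ there is $r_0>0$ such that for every $r_\varphi\in(0,r_0)$ the equality holds for all $x\in S^\times$. -/

import Mathlib

/-- A finite Markov decision process with states `S` and actions `A`: `act s` is the (nonempty) set
of actions allowed in `s`, `P s a s'` is the transition probability, `R` the reward function and
`γ` the discount factor. -/
structure MDP (S A : Type*) [Fintype S] where
  s₀ : S
  act : S → Set A
  act_nonempty : ∀ s, (act s).Nonempty
  P : S → A → S → ℝ
  P_nonneg : ∀ s a s', 0 ≤ P s a s'
  P_sum_of_mem : ∀ s a, a ∈ act s → ∑ s', P s a s' = 1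
  P_sum_of_notMem : ∀ s a, a ∉ act s → ∑ s', P s a s' = 0
  R : S → ℝ
  γ : ℝ
  γ_nonneg : 0 ≤ γ
  γ_lt_one : γ < 1

/-- A labeled MDP: every state carries a set of atomic propositions. -/
structure LabeledMDP (S A AP : Type*) [Fintype S] extends MDP S A where
  L : S → Set AP

/-- The safety condition `□ B`: the path only visits states of `B`. -/
def always {S : Type*} (B : Set S) : Set (ℕ → S) := {ρ | ∀ t, ρ t ∈ B}

/-- The Büchi condition `□ ◇ B`: the path visits `B` infinitely often. -/
def alwaysEventually {S : Type*} (B : Set S) : Set (ℕ → S) := {ρ | ∀ n, ∃ t, n ≤ t ∧ ρ t ∈ B}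

/-- The return of a path for a state-based reward `R` and a state-based discount `Γ`. -/
noncomputable def pathReturn {S : Type*} (R Γ : S → ℝ) (ρ : ℕ → S) : ℝ :=
  ∑' t : ℕ, (∏ i ∈ Finset.range (t + 1), Γ (ρ i)) * R (ρ t)

namespace MDP

variable {S A : Type*} [Fintype S]

open Classical in
/-- The MDP in which only the actions in `C s` are kept in each state `s`. -/
noncomputable def prune (M : MDP S A) (C : S → Set A) (hC : ∀ s, C s ⊆ M.act s)
    (hne : ∀ s, (C s).Nonempty) : MDP S A where
  s₀ := M.s₀
  act := C
  act_nonempty := hne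
  P s a s' := if a ∈ C s then M.P s a s' else 0
  P_nonneg s a s' := by
    by_cases h : a ∈ C s
    · simpa [h] using M.P_nonneg s a s'
    · simp [h]
  P_sum_of_mem s a h := by simpa [h] using M.P_sum_of_mem s a (hC s h)
  P_sum_of_notMem s a h := by simp [h]
  R := M.R
  γ := M.γ
  γ_nonneg := M.γ_nonneg
  γ_lt_one := M.γ_lt_one

variable [Fintype A]

/-- A memoryless, possibly mixed, policy: `prob s a` is the probability of choosing the (allowed)
action `a` in the state `s`. -/
structure Policy (M : MDP S A) where
  prob : S → A → ℝ
  prob_nonneg : ∀ s a, 0 ≤ prob s a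
  prob_sum : ∀ s, ∑ a, prob s a = 1
  prob_eq_zero : ∀ s a, a ∉ M.act s → prob s a = 0

/-- One-step transition probabilities of the Markov chain induced by a policy. -/
noncomputable def stepProb (M : MDP S A) (π : M.Policy) (s s' : S) : ℝ :=
  ∑ a, π.prob s a * M.P s a s'

theorem stepProb_nonneg (M : MDP S A) (π : M.Policy) (s s' : S) : 0 ≤ M.stepProb π s s' :=
  Finset.sum_nonneg fun a _ => mul_nonneg (π.prob_nonneg s a) (M.P_nonneg s a s')

theorem stepProb_sum (M : MDP S A) (π : M.Policy) (s : S) : ∑ s', M.stepProb π s s' = 1 := by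
  unfold stepProb
  rw [Finset.sum_comm, ← π.prob_sum s]
  refine Finset.sum_congr rfl fun a _ => ?_
  rw [← Finset.mul_sum]
  by_cases h : a ∈ M.act s
  · rw [M.P_sum_of_mem s a h, mul_one]
  · rw [π.prob_eq_zero s a h, zero_mul]

/-- One-step distribution of the induced Markov chain. -/
noncomputable def stepPMF (M : MDP S A) (π : M.Policy) (s : S) : PMF S :=
  PMF.ofFintype (fun s' => ENNReal.ofReal (M.stepProb π s s')) (by
    rw [← ENNReal.ofReal_sum_of_nonneg fun s' _ => M.stepProb_nonneg π s s', M.stepProb_sum π s,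
      ENNReal.ofReal_one])

variable [MeasurableSpace S] [DiscreteMeasurableSpace S]

/-- Transition kernel of the induced Markov chain. -/
noncomputable def stepKernel (M : MDP S A) (π : M.Policy) : ProbabilityTheory.Kernel S S where
  toFun s := (M.stepPMF π s).toMeasure
  measurable' := Measurable.of_discrete

instance (M : MDP S A) (π : M.Policy) : ProbabilityTheory.IsMarkovKernel (M.stepKernel π) :=
  ⟨fun s => inferInstanceAs (MeasureTheory.IsProbabilityMeasure (M.stepPMF π s).toMeasure)⟩

/-- The kernel giving the next state from the history up to time `n`: it depends only on the state
at time `n`. -/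
noncomputable def histKernel (M : MDP S A) (π : M.Policy) (n : ℕ) :
    ProbabilityTheory.Kernel (Finset.Iic n → S) S :=
  (M.stepKernel π).comap (fun x => x ⟨n, Finset.mem_Iic.2 le_rfl⟩) (measurable_pi_apply _)

instance (M : MDP S A) (π : M.Policy) (n : ℕ) :
    ProbabilityTheory.IsMarkovKernel (M.histKernel π n) := by
  unfold histKernel; infer_instance

/-- The law of the path `s₀ s₁ …` of the induced Markov chain started in the state `s`. -/
noncomputable def pathLaw (M : MDP S A) (π : M.Policy) (s : S) :
    MeasureTheory.Measure (ℕ → S) :=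
  ProbabilityTheory.Kernel.traj (X := fun _ => S) (M.histKernel π) 0 (fun _ => s)

/-- Probability that the path started in `s` under the policy `π` satisfies `φ`. -/
noncomputable def pr (M : MDP S A) (π : M.Policy) (s : S) (φ : Set (ℕ → S)) : ℝ :=
  (M.pathLaw π s).real φ

/-- Probability of `φ` after taking the action `a` in `s` and following `π` afterwards. -/
noncomputable def prAct (M : MDP S A) (π : M.Policy) (s : S) (a : A) (φ : Set (ℕ → S)) : ℝ :=
  ∑ s', M.P s a s' * M.pr π s' φ

/-- Maximum (over the memoryless policies) probability of `φ` after taking `a` in `s`. -/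
noncomputable def prMax (M : MDP S A) (s : S) (a : A) (φ : Set (ℕ → S)) : ℝ :=
  ⨆ π : M.Policy, M.prAct π s a φ

/-- The allowed actions in `s` with the maximum satisfaction probability for `φ`. -/
def optAct (M : MDP S A) (φ : Set (ℕ → S)) (s : S) : Set A :=
  {a | a ∈ M.act s ∧ ∀ b ∈ M.act s, M.prMax s b φ ≤ M.prMax s a φ}

theorem optAct_subset (M : MDP S A) (φ : Set (ℕ → S)) (s : S) : M.optAct φ s ⊆ M.act s :=
  fun _ h => h.1

theorem optAct_nonempty (M : MDP S A) (φ : Set (ℕ → S)) (s : S) : (M.optAct φ s).Nonempty := by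
  obtain ⟨a, ha, h⟩ := (Set.toFinite (M.act s)).exists_maximalFor (fun a => M.prMax s a φ) _
    (M.act_nonempty s)
  refine ⟨a, ha, fun b hb => ?_⟩
  rcases le_total (M.prMax s b φ) (M.prMax s a φ) with h' | h'
  · exact h'
  · exact h hb h'

/-- Expected return, for the reward `R` and the discount `Γ`, of the path started in `s`. -/
noncomputable def expReturn (M : MDP S A) (R Γ : S → ℝ) (π : M.Policy) (s : S) : ℝ :=
  ∫ ρ, pathReturn R Γ ρ ∂(M.pathLaw π s)

/-- Maximum expected return obtained after taking the action `a` in `s`. -/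
noncomputable def qMax (M : MDP S A) (R Γ : S → ℝ) (s : S) (a : A) : ℝ :=
  ⨆ π : M.Policy, ∑ s', M.P s a s' * M.expReturn R Γ π s'

/-- The largest `qMax` over the allowed actions in `s`. -/
noncomputable def vMax (M : MDP S A) (R Γ : S → ℝ) (s : S) : ℝ :=
  ⨆ a : M.act s, M.qMax R Γ s a

end MDP

/-- A safety automaton over the alphabet `Set AP`: the transitions are deterministic and the
non-accepting states are absorbing. -/
structure SafetyAutomaton (Q AP : Type*) where
  q₀ : Q
  δ : Q → Set AP → Q
  B : Set Q
  absorbing : ∀ q θ, q ∉ B → δ q θ = q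

/-- A (suitable) limit-deterministic Büchi automaton over the alphabet `Set AP`; `none` stands for
`ε`. The states split into an initial component `QAᶜ` and an accepting component `QA` which contains
`B`, has no `ε`-transitions and cannot be left; every `ε`-transition leads into `QA`. -/
structure LDBA (Q AP : Type*) where
  q₀ : Q
  δ : Q → Option (Set AP) → Set Q
  B : Set Q
  singleton : ∀ q (θ : Set AP), ∃ q', δ q (some θ) = {q'}
  components : ∃ QA : Set Q, B ⊆ QA ∧
    (∀ q ∈ QA, δ q none = ∅ ∧ ∀ θ : Set AP, δ q (some θ) ⊆ QA) ∧
    ∀ q, δ q none ⊆ QA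

section Product

variable {S A AP Qψ Qφ : Type*} [Fintype S] [Fintype Qψ] [Fintype Qφ]

/-- Actions allowed in the product: those of the MDP and an `ε`-action for every `ε`-successor. -/
def prodAct (M : LabeledMDP S A AP) (Aφ : LDBA Qφ AP) : S × Qψ × Qφ → Set (A ⊕ Qφ)
  | (s, _, _), Sum.inl a => a ∈ M.act s
  | (_, _, p), Sum.inr p' => p' ∈ Aφ.δ p none

open Classical in
/-- Transition probabilities of the product. -/
noncomputable def prodP (M : LabeledMDP S A AP) (Aψ : SafetyAutomaton Qψ AP) (Aφ : LDBA Qφ AP) :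
    S × Qψ × Qφ → A ⊕ Qφ → S × Qψ × Qφ → ℝ
  | (s, q, p), Sum.inl a, (s', q', p') =>
    if a ∈ M.act s ∧ q' = Aψ.δ q (M.L s) ∧ p' ∈ Aφ.δ p (some (M.L s)) then M.P s a s' else 0
  | (s, q, p), Sum.inr e, (s', q', p') =>
    if p' = e ∧ e ∈ Aφ.δ p none ∧ q' = q ∧ s' = s then 1 else 0

/-- The product MDP of a labeled MDP, a safety automaton and an LDBA. -/
noncomputable def prodMDP (M : LabeledMDP S A AP) (Aψ : SafetyAutomaton Qψ AP)
    (Aφ : LDBA Qφ AP) : MDP (S × Qψ × Qφ) (A ⊕ Qφ) where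
  s₀ := (M.s₀, Aψ.q₀, Aφ.q₀)
  act := prodAct M Aφ
  act_nonempty := by
    rintro ⟨s, q, p⟩
    obtain ⟨a, ha⟩ := M.act_nonempty s
    exact ⟨Sum.inl a, ha⟩
  P := prodP M Aψ Aφ
  P_nonneg := by
    rintro ⟨s, q, p⟩ (a | e) ⟨s', q', p'⟩
    · simp only [prodP]
      split_ifs
      · exact M.P_nonneg _ _ _
      · exact le_rfl
    · simp only [prodP]
      split_ifs <;> norm_num
  P_sum_of_mem := by
    classical
    rintro ⟨s, q, p⟩ (a | e) h
    · have ha : a ∈ M.act s := h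
      obtain ⟨p₁, hp⟩ := Aφ.singleton p (M.L s)
      rw [← M.P_sum_of_mem s a ha, Fintype.sum_prod_type]
      refine Finset.sum_congr rfl fun s' _ => ?_
      rw [Fintype.sum_eq_single (Aψ.δ q (M.L s), p₁)]
      · simp [prodP, ha, hp]
      · rintro ⟨q', p'⟩ hne
        simp only [prodP, hp, Set.mem_singleton_iff]
        refine if_neg fun hc => hne ?_
        rw [hc.2.1, hc.2.2]
    · have he : e ∈ Aφ.δ p none := h
      rw [Fintype.sum_eq_single (s, q, e)]
      · simp [prodP, he]
      · rintro ⟨s', q', p'⟩ hne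
        simp only [prodP]
        refine if_neg fun hc => hne ?_
        rw [hc.1, hc.2.2.1, hc.2.2.2]
  P_sum_of_notMem := by
    rintro ⟨s, q, p⟩ (a | e) h
    · have ha : a ∉ M.act s := h
      refine Finset.sum_eq_zero ?_
      rintro ⟨s', q', p'⟩ -
      simp [prodP, ha]
    · have he : e ∉ Aφ.δ p none := h
      refine Finset.sum_eq_zero ?_
      rintro ⟨s', q', p'⟩ -
      simp [prodP, he]
  R := fun x => M.R x.1
  γ := M.γ
  γ_nonneg := M.γ_nonneg
  γ_lt_one := M.γ_lt_one

/-- The product states accepting for the safety automaton. -/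
def prodBψ (S Qφ : Type*) {Qψ AP : Type*} (Aψ : SafetyAutomaton Qψ AP) : Set (S × Qψ × Qφ) :=
  {x | x.2.1 ∈ Aψ.B}

/-- The product states accepting for the LDBA. -/
def prodBφ (S Qψ : Type*) {Qφ AP : Type*} (Aφ : LDBA Qφ AP) : Set (S × Qψ × Qφ) :=
  {x | x.2.2 ∈ Aφ.B}

variable [Fintype A] [MeasurableSpace S] [DiscreteMeasurableSpace S] [MeasurableSpace Qψ]
  [DiscreteMeasurableSpace Qψ] [MeasurableSpace Qφ] [DiscreteMeasurableSpace Qφ]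

/-- The actions of the product with the maximum satisfaction probability for the safety
condition. -/
noncomputable def safeAct (M : LabeledMDP S A AP) (Aψ : SafetyAutomaton Qψ AP) (Aφ : LDBA Qφ AP) :
    S × Qψ × Qφ → Set (A ⊕ Qφ) :=
  (prodMDP M Aψ Aφ).optAct (always (prodBψ S Qφ Aψ))

/-- The product MDP with all the actions outside `safeAct` pruned. -/
noncomputable def prunedMDP (M : LabeledMDP S A AP) (Aψ : SafetyAutomaton Qψ AP)
    (Aφ : LDBA Qφ AP) : MDP (S × Qψ × Qφ) (A ⊕ Qφ) :=
  (prodMDP M Aψ Aφ).prune (safeAct M Aψ Aφ) ((prodMDP M Aψ Aφ).optAct_subset _)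
    ((prodMDP M Aψ Aφ).optAct_nonempty _)

/-- The actions of the pruned product with the maximum (in the pruned product) satisfaction
probability for the Büchi condition. -/
noncomputable def buchiAct (M : LabeledMDP S A AP) (Aψ : SafetyAutomaton Qψ AP)
    (Aφ : LDBA Qφ AP) : S × Qψ × Qφ → Set (A ⊕ Qφ) :=
  (prunedMDP M Aψ Aφ).optAct (alwaysEventually (prodBφ S Qψ Aφ))

end Product

open Classical in
/-- The reward `r` on the states of `B` and `0` elsewhere. -/
noncomputable def buchiReward {S : Type*} (B : Set S) (r : ℝ) (s : S) : ℝ :=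
  if s ∈ B then r else 0

open Classical in
/-- The discount `1 - r` on the states of `B` and `1 - r ^ 2` elsewhere. -/
noncomputable def buchiDiscount {S : Type*} (B : Set S) (r : ℝ) (s : S) : ℝ :=
  if s ∈ B then 1 - r else 1 - r ^ 2

/-! The core is `tendsto_qMax`: in any finite MDP and for any set `B`, the maximum expected return
after an action tends, as `r → 0+`, to the maximum probability of `□ ◇ B`. There are finitely many
limit values, so a tolerance below their smallest positive gap separates optimal from non-optimal
actions once `r` is small. This is applied to the pruned product.

For a fixed policy the return tends to the Büchi probability. From above
(`eventually_expReturn_le`): a path that avoids `B` from time `n` on earns at most `n * r`, and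
every path earns at most `1`. From below (`exists_pr_le_expReturn_add`): the error is bounded by a
maximum principle on the induced chain, `exists_uniform_bound_of_reachable`, whose constant depends
on the chain and not on `r`. It is used twice: for the loss `1 - G` where `B` always remains
reachable (`exists_one_sub_expReturn_le`), then for probability minus return on the whole chain. No
decomposition into recurrent classes is needed.

The upper bound must be uniform over policies. For each `r` a deterministic policy is optimal
(`exists_optimal_selector`), and there are finitely many of these. -/

open MeasureTheory ProbabilityTheory Filter Topology

/-! ### Path laws: cylinders and the first-step decomposition. -/

/-- The path that starts in `s` and continues with `ρ`. -/
def pathCons {S : Type*} (s : S) (ρ : ℕ → S) : ℕ → S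
  | 0 => s
  | n + 1 => ρ n

@[simp] theorem pathCons_zero {S : Type*} (s : S) (ρ : ℕ → S) : pathCons s ρ 0 = s := rfl

@[simp] theorem pathCons_succ {S : Type*} (s : S) (ρ : ℕ → S) (n : ℕ) :
    pathCons s ρ (n + 1) = ρ n := rfl

theorem measurable_pathCons {S : Type*} [MeasurableSpace S] (s : S) :
    Measurable (pathCons s) := by
  refine measurable_pi_iff.2 fun n => ?_
  cases n with
  | zero => exact measurable_const
  | succ n => exact measurable_pi_apply n

/-- Two probability laws of paths in a finite set agree if they agree on cylinders. -/
theorem pathMeasure_ext {S : Type*} [Finite S] [MeasurableSpace S] [DiscreteMeasurableSpace S]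
    {μ ν : Measure (ℕ → S)} [IsFiniteMeasure μ] [IsFiniteMeasure ν]
    (h : ∀ (n : ℕ) (x : ℕ → S), μ {ρ | ∀ i ≤ n, ρ i = x i} = ν {ρ | ∀ i ≤ n, ρ i = x i}) :
    μ = ν := by
  have key : ∀ n, ν.map (Preorder.frestrictLe n) = μ.map (Preorder.frestrictLe n) := by
    intro n
    refine Measure.ext_of_singleton fun y => ?_
    rw [Measure.map_apply (Preorder.measurable_frestrictLe n) (measurableSet_singleton y),
      Measure.map_apply (Preorder.measurable_frestrictLe n) (measurableSet_singleton y)]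
    -- A cylinder is indexed by a full sequence, so the finite history `y` is extended past `n` by
    -- its last value.
    have hy : (Preorder.frestrictLe (π := fun _ => S) n) ⁻¹' {y} =
        {ρ | ∀ i ≤ n, ρ i = (fun i => y ⟨min i n, Finset.mem_Iic.2 (min_le_right i n)⟩) i} := by
      ext ρ
      simp only [Set.mem_preimage, Set.mem_singleton_iff, Set.mem_ofPred_eq]
      constructor
      · rintro rfl i hi
        simp [Preorder.frestrictLe, min_eq_left hi]
      · intro H
        funext ⟨i, hi⟩
        have := H i (Finset.mem_Iic.1 hi)
        simpa [Preorder.frestrictLe, min_eq_left (Finset.mem_Iic.1 hi)] using this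
    rw [hy]
    exact (h n _).symm
  have hproj : IsProjectiveMeasureFamily (α := fun _ : ℕ => S)
      (fun I : Finset ℕ => μ.map I.restrict) := by
    intro I J hJI
    rw [Measure.map_map (Finset.measurable_restrict₂ hJI) (Finset.measurable_restrict I)]
    rfl
  have h1 : IsProjectiveLimit μ (α := fun _ : ℕ => S)
      (fun I : Finset ℕ => μ.map I.restrict) :=
    fun I => rfl
  have h2 : IsProjectiveLimit ν (α := fun _ : ℕ => S)
      (fun I : Finset ℕ => μ.map I.restrict) :=
    (isProjectiveLimit_nat_iff hproj ν).2 key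
  exact h1.unique h2

namespace MDP

variable {S A : Type*} [Fintype S] [Fintype A] [MeasurableSpace S] [DiscreteMeasurableSpace S]

instance (M : MDP S A) (π : M.Policy) (s : S) : IsProbabilityMeasure (M.pathLaw π s) := by
  unfold pathLaw; infer_instance

theorem stepKernel_singleton (M : MDP S A) (π : M.Policy) (s s' : S) :
    M.stepKernel π s {s'} = ENNReal.ofReal (M.stepProb π s s') := by
  change (M.stepPMF π s).toMeasure {s'} = _
  rw [PMF.toMeasure_apply_singleton _ _ (measurableSet_singleton s')]
  rfl

-- Each step of the induction splits off the last coordinate of the trajectory kernel. Through this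
-- formula the history-dependent construction reduces to the one-step probabilities.
open Classical in
theorem pathLaw_cylinder (M : MDP S A) (π : M.Policy) (s : S) (n : ℕ) (x : ℕ → S) :
    M.pathLaw π s {ρ | ∀ i ≤ n, ρ i = x i} =
      if x 0 = s then ∏ i ∈ Finset.range n, ENNReal.ofReal (M.stepProb π (x i) (x (i + 1)))
      else 0 := by
  induction n with
  | zero =>
    have h := Kernel.traj_map_frestrictLe_apply (X := fun _ => S) (κ := M.histKernel π) 0 0
      (fun _ => s)
    rw [Kernel.partialTraj_self, Kernel.id_apply] at h
    have h' := congrArg (fun μ => μ {y | y ⟨0, by simp⟩ = x 0}) h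
    beta_reduce at h'
    rw [Measure.map_apply (Preorder.measurable_frestrictLe 0) (Set.toFinite _).measurableSet] at h'
    have hset : {ρ : ℕ → S | ∀ i ≤ 0, ρ i = x i} = (Preorder.frestrictLe (π := fun _ => S) 0) ⁻¹'
        {y | y ⟨0, by simp⟩ = x 0} := by
      ext ρ
      simp [Preorder.frestrictLe]
    rw [hset]
    refine Eq.trans h' ?_
    rw [Measure.dirac_apply' _ (Set.toFinite _).measurableSet]
    simp [Set.indicator_apply, eq_comm]
  | succ n ih =>
    have h := Kernel.partialTraj_compProd_eq_map_traj (X := fun _ => S) (κ := M.histKernel π)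
      (Nat.zero_le n) (x₀ := fun _ => s)
    have h' := congrArg (fun μ => μ ({Preorder.frestrictLe n x} ×ˢ {x (n + 1)})) h
    beta_reduce at h'
    rw [Measure.map_apply (by fun_prop)
      ((measurableSet_singleton _).prod (measurableSet_singleton _)),
      Measure.compProd_apply_prod (measurableSet_singleton _) (measurableSet_singleton _),
      lintegral_singleton, ← Kernel.traj_map_frestrictLe_apply,
      Measure.map_apply (Preorder.measurable_frestrictLe n) (measurableSet_singleton _)] at h'
    have hset : {ρ : ℕ → S | ∀ i ≤ n, ρ i = x i} =
        (Preorder.frestrictLe (π := fun _ => S) n) ⁻¹' {Preorder.frestrictLe n x} := by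
      ext ρ
      simp [Preorder.frestrictLe, funext_iff]
    have hset' : {ρ : ℕ → S | ∀ i ≤ n + 1, ρ i = x i} =
        (fun ρ => (Preorder.frestrictLe (π := fun _ => S) n ρ, ρ (n + 1))) ⁻¹'
          ({Preorder.frestrictLe n x} ×ˢ {x (n + 1)}) := by
      ext ρ
      simp [Preorder.frestrictLe, funext_iff, Nat.le_succ_iff, or_imp, forall_and]
    rw [hset']
    refine Eq.trans h'.symm ?_
    rw [← hset]
    change M.stepKernel π (x n) {x (n + 1)} * M.pathLaw π s _ = _
    rw [ih, M.stepKernel_singleton, Finset.prod_range_succ, mul_comm]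
    split_ifs <;> simp

/-- The Markov property at time `1`. -/
theorem pathLaw_eq_sum (M : MDP S A) (π : M.Policy) (s : S) :
    M.pathLaw π s =
      ∑ s', ENNReal.ofReal (M.stepProb π s s') • (M.pathLaw π s').map (pathCons s) := by
  classical
  have hν : ∀ s', IsProbabilityMeasure ((M.pathLaw π s').map (pathCons s)) := fun s' =>
    Measure.isProbabilityMeasure_map (measurable_pathCons s).aemeasurable
  have hone : ∑ s', ENNReal.ofReal (M.stepProb π s s') = 1 := by
    rw [← ENNReal.ofReal_sum_of_nonneg fun s' _ => M.stepProb_nonneg π s s', M.stepProb_sum π s,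
      ENNReal.ofReal_one]
  have happ : ∀ T, (∑ s', ENNReal.ofReal (M.stepProb π s s') •
      (M.pathLaw π s').map (pathCons s)) T =
      ∑ s', ENNReal.ofReal (M.stepProb π s s') * (M.pathLaw π s').map (pathCons s) T := by
    intro T
    simp [Measure.finsetSum_apply]
  have : IsFiniteMeasure (∑ s', ENNReal.ofReal (M.stepProb π s s') •
      (M.pathLaw π s').map (pathCons s)) := by
    constructor
    rw [happ]
    simp [hone]
  refine pathMeasure_ext fun n x => ?_
  have hcyl : MeasurableSet {ρ : ℕ → S | ∀ i ≤ n, ρ i = x i} := by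
    simp only [Set.ofPred_forall]
    exact .iInter fun i => .iInter fun _ => (measurable_pi_apply (X := fun _ => S) i) (measurableSet_singleton (x i))
  rw [happ, pathLaw_cylinder]
  simp only [Measure.map_apply (measurable_pathCons s) hcyl]
  cases n with
  | zero =>
    by_cases h : x 0 = s
    · simp [h, hone]
    · have : pathCons s ⁻¹' {ρ : ℕ → S | ∀ i ≤ 0, ρ i = x i} = ∅ := by
        ext ρ; simp [Ne.symm h]
      rw [this]; simp [h]
  | succ n =>
    by_cases h : x 0 = s
    · have : pathCons s ⁻¹' {ρ : ℕ → S | ∀ i ≤ n + 1, ρ i = x i} =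
          {ρ | ∀ i ≤ n, ρ i = x (i + 1)} := by
        ext ρ
        constructor
        · intro H i hi
          exact H (i + 1) (by omega)
        · rintro H (_ | i) hi
          · exact h.symm
          · exact H i (by omega)
      rw [this, if_pos h]
      simp only [pathLaw_cylinder M π _ n (fun i => x (i + 1))]
      simp [Finset.prod_range_succ', h, mul_comm]
    · have : pathCons s ⁻¹' {ρ : ℕ → S | ∀ i ≤ n + 1, ρ i = x i} = ∅ := by
        ext ρ
        simp only [Set.mem_preimage, Set.mem_ofPred_eq, Set.mem_empty_iff_false, iff_false]
        intro H
        exact h (H 0 (by omega)).symm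
      rw [this]; simp [h]

theorem integral_pathLaw (M : MDP S A) (π : M.Policy) (s : S) {F : (ℕ → S) → ℝ} {K : ℝ}
    (hF : Measurable F) (hK : ∀ ρ, |F ρ| ≤ K) :
    ∫ ρ, F ρ ∂(M.pathLaw π s) =
      ∑ s', M.stepProb π s s' * ∫ ρ, F (pathCons s ρ) ∂(M.pathLaw π s') := by
  have hν : ∀ s', IsProbabilityMeasure ((M.pathLaw π s').map (pathCons s)) := fun s' =>
    Measure.isProbabilityMeasure_map (measurable_pathCons s).aemeasurable
  rw [M.pathLaw_eq_sum π s, integral_finsetSum_measure]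
  · refine Finset.sum_congr rfl fun s' _ => ?_
    rw [integral_smul_measure, integral_map (measurable_pathCons s).aemeasurable
      hF.aestronglyMeasurable, ENNReal.toReal_ofReal (M.stepProb_nonneg π s s'), smul_eq_mul]
  · intro s' _
    refine Integrable.smul_measure ?_ ENNReal.ofReal_ne_top
    exact Integrable.of_bound hF.aestronglyMeasurable K (.of_forall hK)

theorem pr_eq_sum (M : MDP S A) (π : M.Policy) (s : S) {φ : Set (ℕ → S)} (hφ : MeasurableSet φ) :
    M.pr π s φ = ∑ s', M.stepProb π s s' * M.pr π s' (pathCons s ⁻¹' φ) := by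
  have h := M.integral_pathLaw π s (F := φ.indicator 1) (K := 1)
    (measurable_one.indicator hφ) (fun ρ => by
      by_cases h : ρ ∈ φ <;> simp [h])
  rw [integral_indicator_one hφ] at h
  rw [pr, h]
  refine Finset.sum_congr rfl fun s' _ => ?_
  rw [pr, ← integral_indicator_one (measurable_pathCons s hφ)]
  rfl

end MDP

/-! ### Pathwise bounds on the return. -/

section Return

variable {S : Type*} {B : Set S} {r : ℝ}

theorem buchiReward_nonneg (hr0 : 0 < r) (s : S) : 0 ≤ buchiReward B r s := by
  unfold buchiReward
  split_ifs
  exacts [hr0.le, le_rfl]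

theorem buchiReward_le (hr0 : 0 < r) (s : S) : buchiReward B r s ≤ r := by
  unfold buchiReward
  split_ifs
  exacts [le_rfl, hr0.le]

theorem buchiDiscount_nonneg (hr0 : 0 < r) (hr1 : r < 1) (s : S) : 0 ≤ buchiDiscount B r s := by
  unfold buchiDiscount
  split_ifs <;> nlinarith

theorem buchiDiscount_lt_one (hr0 : 0 < r) (s : S) : buchiDiscount B r s < 1 := by
  unfold buchiDiscount
  split_ifs <;> nlinarith

theorem le_buchiDiscount (hr0 : 0 < r) (hr1 : r < 1) (s : S) : 1 - r ≤ buchiDiscount B r s := by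
  unfold buchiDiscount
  split_ifs <;> nlinarith

/-- The discount and the reward are tuned such that the loss `1 - G` of the return satisfies
`1 - G = r ^ 2 + Γ * (1 - G')`. -/
theorem buchiDiscount_mul_add (s : S) :
    buchiDiscount B r s * (buchiReward B r s + 1) = 1 - r ^ 2 := by
  unfold buchiDiscount buchiReward
  split_ifs <;> ring

theorem prod_buchiDiscount_nonneg (hr0 : 0 < r) (hr1 : r < 1) (ρ : ℕ → S) (n : ℕ) :
    0 ≤ ∏ i ∈ Finset.range n, buchiDiscount B r (ρ i) :=
  Finset.prod_nonneg fun i _ => buchiDiscount_nonneg hr0 hr1 (ρ i)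

theorem pathReturn_term_nonneg (hr0 : 0 < r) (hr1 : r < 1) (ρ : ℕ → S) (t : ℕ) :
    0 ≤ (∏ i ∈ Finset.range (t + 1), buchiDiscount B r (ρ i)) * buchiReward B r (ρ t) :=
  mul_nonneg (prod_buchiDiscount_nonneg hr0 hr1 ρ _) (buchiReward_nonneg hr0 _)

/-- The sum telescopes: since `Γ * (R + 1) = 1 - r ^ 2 ≤ 1`, the term `Γ * R` is at most `1 - Γ`, so
each new summand is at most the drop of the discount product. -/
theorem pathReturn_partial_sum_le (hr0 : 0 < r) (hr1 : r < 1) (ρ : ℕ → S) (n : ℕ) :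
    ∑ t ∈ Finset.range n, (∏ i ∈ Finset.range (t + 1), buchiDiscount B r (ρ i)) *
      buchiReward B r (ρ t) ≤ 1 - ∏ i ∈ Finset.range n, buchiDiscount B r (ρ i) := by
  induction n with
  | zero => simp
  | succ n ih =>
    rw [Finset.sum_range_succ, Finset.prod_range_succ]
    have h := buchiDiscount_mul_add (B := B) (r := r) (ρ n)
    nlinarith [prod_buchiDiscount_nonneg (B := B) hr0 hr1 ρ n,
      mul_nonneg (prod_buchiDiscount_nonneg (B := B) hr0 hr1 ρ n) (sq_nonneg r)]

theorem pathReturn_partial_sum_le_one (hr0 : 0 < r) (hr1 : r < 1) (ρ : ℕ → S) (n : ℕ) :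
    ∑ t ∈ Finset.range n, (∏ i ∈ Finset.range (t + 1), buchiDiscount B r (ρ i)) *
      buchiReward B r (ρ t) ≤ 1 :=
  (pathReturn_partial_sum_le hr0 hr1 ρ n).trans
    (sub_le_self _ (prod_buchiDiscount_nonneg hr0 hr1 ρ n))

theorem summable_pathReturn (hr0 : 0 < r) (hr1 : r < 1) (ρ : ℕ → S) :
    Summable fun t : ℕ => (∏ i ∈ Finset.range (t + 1), buchiDiscount B r (ρ i)) *
      buchiReward B r (ρ t) :=
  summable_of_sum_range_le (pathReturn_term_nonneg hr0 hr1 ρ)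
    (pathReturn_partial_sum_le_one hr0 hr1 ρ)

theorem pathReturn_nonneg (hr0 : 0 < r) (hr1 : r < 1) (ρ : ℕ → S) :
    0 ≤ pathReturn (buchiReward B r) (buchiDiscount B r) ρ :=
  tsum_nonneg (pathReturn_term_nonneg hr0 hr1 ρ)

theorem pathReturn_le_one (hr0 : 0 < r) (hr1 : r < 1) (ρ : ℕ → S) :
    pathReturn (buchiReward B r) (buchiDiscount B r) ρ ≤ 1 :=
  Real.tsum_le_of_sum_range_le (pathReturn_term_nonneg hr0 hr1 ρ)
    (pathReturn_partial_sum_le_one hr0 hr1 ρ)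

theorem abs_pathReturn_le_one (hr0 : 0 < r) (hr1 : r < 1) (ρ : ℕ → S) :
    |pathReturn (buchiReward B r) (buchiDiscount B r) ρ| ≤ 1 := by
  rw [abs_of_nonneg (pathReturn_nonneg hr0 hr1 ρ)]
  exact pathReturn_le_one hr0 hr1 ρ

theorem pathReturn_pathCons (hr0 : 0 < r) (hr1 : r < 1) (s : S) (ρ : ℕ → S) :
    pathReturn (buchiReward B r) (buchiDiscount B r) (pathCons s ρ) =
      buchiDiscount B r s *
        (buchiReward B r s + pathReturn (buchiReward B r) (buchiDiscount B r) ρ) := by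
  unfold pathReturn
  rw [(summable_pathReturn hr0 hr1 (pathCons s ρ)).tsum_eq_zero_add, mul_add, ← tsum_mul_left]
  congr 1
  · simp
  · refine tsum_congr fun t => ?_
    rw [Finset.prod_range_succ']
    simp only [pathCons_zero, pathCons_succ]
    ring

theorem pathReturn_le_of_forall_notMem (hr0 : 0 < r) (hr1 : r < 1) {ρ : ℕ → S} {n : ℕ}
    (h : ∀ t, n ≤ t → ρ t ∉ B) :
    pathReturn (buchiReward B r) (buchiDiscount B r) ρ ≤ n * r := by
  unfold pathReturn
  rw [tsum_eq_sum (s := Finset.range n)]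
  · calc _ ≤ ∑ _t ∈ Finset.range n, r := by
          refine Finset.sum_le_sum fun t _ => ?_
          have h1 : ∏ i ∈ Finset.range (t + 1), buchiDiscount B r (ρ i) ≤ 1 :=
            Finset.prod_le_one (fun i _ => buchiDiscount_nonneg hr0 hr1 _)
              fun i _ => (buchiDiscount_lt_one hr0 _).le
          exact (mul_le_of_le_one_left (buchiReward_nonneg hr0 _) h1).trans (buchiReward_le hr0 _)
      _ = n * r := by simp
  · intro t ht
    have : ρ t ∉ B := h t (by simpa using ht)
    simp [buchiReward, this]

theorem measurable_pathReturn [MeasurableSpace S] [DiscreteMeasurableSpace S]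
    (hr0 : 0 < r) (hr1 : r < 1) :
    Measurable (pathReturn (buchiReward B r) (buchiDiscount B r)) := by
  have hc : ∀ (f : S → ℝ) (i : ℕ), Measurable fun ρ : ℕ → S => f (ρ i) := fun f i =>
    (Measurable.of_discrete (f := f)).comp (measurable_pi_apply i)
  refine measurable_of_tendsto_metrizable (f := fun n (ρ : ℕ → S) =>
    ∑ t ∈ Finset.range n, (∏ i ∈ Finset.range (t + 1), buchiDiscount B r (ρ i)) *
      buchiReward B r (ρ t)) (fun n => ?_) ?_
  · exact Finset.measurable_fun_sum _ fun t _ =>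
      (Finset.measurable_fun_prod _ fun i _ => hc _ i).mul (hc _ t)
  · exact tendsto_pi_nhds.2 fun ρ => (summable_pathReturn hr0 hr1 ρ).hasSum.tendsto_sum_nat

theorem measurableSet_alwaysEventually [MeasurableSpace S] [DiscreteMeasurableSpace S]
    (B : Set S) : MeasurableSet (alwaysEventually B) := by
  have : alwaysEventually B = ⋂ n, ⋃ t, ⋃ (_ : n ≤ t), (fun ρ : ℕ → S => ρ t) ⁻¹' B := by
    ext ρ
    simp [alwaysEventually]
  rw [this]
  exact .iInter fun n => .iUnion fun t => .iUnion fun _ => measurable_pi_apply t .of_discrete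

theorem pathCons_preimage_alwaysEventually (B : Set S) (s : S) :
    pathCons s ⁻¹' alwaysEventually B = alwaysEventually B := by
  ext ρ
  simp only [alwaysEventually, Set.mem_preimage, Set.mem_ofPred_eq]
  constructor
  · intro h n
    obtain ⟨_ | t, ht, hB⟩ := h (n + 1)
    · omega
    · exact ⟨t, by omega, hB⟩
  · intro h n
    obtain ⟨t, ht, hB⟩ := h n
    exact ⟨t + 1, by omega, hB⟩

end Return

/-! ### Expected return of a fixed policy: Bellman equation and upper bound. -/

namespace MDP

variable {S A : Type*} [Fintype S] [Fintype A] [MeasurableSpace S] [DiscreteMeasurableSpace S]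

theorem pr_le_one (M : MDP S A) (π : M.Policy) (s : S) (φ : Set (ℕ → S)) : M.pr π s φ ≤ 1 :=
  measureReal_le_one

theorem pr_alwaysEventually (M : MDP S A) (π : M.Policy) (B : Set S) (s : S) :
    M.pr π s (alwaysEventually B) =
      ∑ s', M.stepProb π s s' * M.pr π s' (alwaysEventually B) := by
  rw [M.pr_eq_sum π s (measurableSet_alwaysEventually B), pathCons_preimage_alwaysEventually]

variable {r : ℝ}

theorem expReturn_nonneg (M : MDP S A) (π : M.Policy) (B : Set S) (hr0 : 0 < r) (hr1 : r < 1)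
    (s : S) : 0 ≤ M.expReturn (buchiReward B r) (buchiDiscount B r) π s :=
  integral_nonneg fun ρ => pathReturn_nonneg hr0 hr1 ρ

theorem integrable_pathReturn (M : MDP S A) (π : M.Policy) (B : Set S) (hr0 : 0 < r)
    (hr1 : r < 1) (s : S) :
    Integrable (pathReturn (buchiReward B r) (buchiDiscount B r)) (M.pathLaw π s) :=
  Integrable.of_bound (measurable_pathReturn hr0 hr1).aestronglyMeasurable 1
    (.of_forall (abs_pathReturn_le_one hr0 hr1))

theorem expReturn_le_one (M : MDP S A) (π : M.Policy) (B : Set S) (hr0 : 0 < r) (hr1 : r < 1)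
    (s : S) : M.expReturn (buchiReward B r) (buchiDiscount B r) π s ≤ 1 := by
  have := integral_mono (M.integrable_pathReturn π B hr0 hr1 s) (integrable_const 1)
    fun ρ => pathReturn_le_one hr0 hr1 ρ
  simpa [expReturn] using this

/-- The Bellman equation of a policy. -/
theorem expReturn_eq (M : MDP S A) (π : M.Policy) (B : Set S) (hr0 : 0 < r) (hr1 : r < 1)
    (s : S) : M.expReturn (buchiReward B r) (buchiDiscount B r) π s =
      buchiDiscount B r s * (buchiReward B r s + ∑ s', M.stepProb π s s' *
        M.expReturn (buchiReward B r) (buchiDiscount B r) π s') := by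
  unfold expReturn
  rw [M.integral_pathLaw π s (measurable_pathReturn hr0 hr1) (abs_pathReturn_le_one hr0 hr1)]
  simp only [pathReturn_pathCons hr0 hr1]
  have : ∀ s', ∫ ρ, buchiDiscount B r s * (buchiReward B r s +
      pathReturn (buchiReward B r) (buchiDiscount B r) ρ) ∂(M.pathLaw π s') =
      buchiDiscount B r s * (buchiReward B r s +
        ∫ ρ, pathReturn (buchiReward B r) (buchiDiscount B r) ρ ∂(M.pathLaw π s')) := by
    intro s'
    rw [integral_const_mul, integral_add (integrable_const _)
      (M.integrable_pathReturn π B hr0 hr1 s')]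
    simp
  simp only [this]
  have hs := M.stepProb_sum π s
  calc _ = buchiDiscount B r s * (buchiReward B r s * ∑ s', M.stepProb π s s' +
        ∑ s', M.stepProb π s s' *
          ∫ ρ, pathReturn (buchiReward B r) (buchiDiscount B r) ρ ∂(M.pathLaw π s')) := by
        rw [Finset.mul_sum, ← Finset.sum_add_distrib, Finset.mul_sum]
        exact Finset.sum_congr rfl fun s' _ => by ring
    _ = _ := by rw [hs, mul_one]

/-- The expected return is asymptotically at most the probability of the Büchi condition. -/
theorem eventually_expReturn_le (M : MDP S A) (π : M.Policy) (B : Set S) (s : S) {ε : ℝ}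
    (hε : 0 < ε) : ∀ᶠ r in 𝓝[>] (0 : ℝ),
      M.expReturn (buchiReward B r) (buchiDiscount B r) π s ≤
        M.pr π s (alwaysEventually B) + ε := by
  -- These events decrease to `□ ◇ B`, so some `n` has probability within `ε / 2` of the limit; only
  -- then is `r` made small enough for `n * r < ε / 2`.
  set E : ℕ → Set (ℕ → S) := fun n => {ρ | ∃ t, n ≤ t ∧ ρ t ∈ B} with hE
  have hEm : ∀ n, MeasurableSet (E n) := by
    intro n
    have : E n = ⋃ t, ⋃ (_ : n ≤ t), (fun ρ : ℕ → S => ρ t) ⁻¹' B := by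
      ext ρ
      simp [hE]
    rw [this]
    exact .iUnion fun t => .iUnion fun _ => measurable_pi_apply t .of_discrete
  have hanti : Antitone E := by
    rintro m n hmn ρ ⟨t, ht, hB⟩
    exact ⟨t, hmn.trans ht, hB⟩
  have hInter : ⋂ n, E n = alwaysEventually B := by
    ext ρ
    simp [hE, alwaysEventually]
  have hlim : Tendsto (fun n => M.pr π s (E n)) atTop (𝓝 (M.pr π s (alwaysEventually B))) := by
    have := tendsto_measure_iInter_atTop (μ := M.pathLaw π s)
      (fun n => (hEm n).nullMeasurableSet) hanti ⟨0, measure_ne_top _ _⟩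
    rw [hInter] at this
    exact (ENNReal.tendsto_toReal (measure_ne_top _ _)).comp this
  obtain ⟨n, hn⟩ := (hlim.eventually_lt_const
    (show _ < M.pr π s (alwaysEventually B) + ε / 2 by linarith)).exists
  have hsmall : ∀ᶠ r in 𝓝[>] (0 : ℝ), (n : ℝ) * r < ε / 2 := by
    have : Tendsto (fun r : ℝ => (n : ℝ) * r) (𝓝[>] 0) (𝓝 ((n : ℝ) * 0)) :=
      ((continuous_const.mul continuous_id).tendsto 0).mono_left nhdsWithin_le_nhds
    exact this.eventually_lt_const (by linarith)
  filter_upwards [hsmall, Ioo_mem_nhdsGT (zero_lt_one' ℝ)] with r hr ⟨hr0, hr1⟩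
  have hbound : ∀ ρ, pathReturn (buchiReward B r) (buchiDiscount B r) ρ ≤
      (E n).indicator 1 ρ + n * r := by
    intro ρ
    by_cases h : ρ ∈ E n
    · rw [Set.indicator_of_mem h]
      have := pathReturn_le_one (B := B) hr0 hr1 ρ
      have : 0 ≤ (n : ℝ) * r := by positivity
      simp only [Pi.one_apply]
      linarith
    · rw [Set.indicator_of_notMem h, zero_add]
      exact pathReturn_le_of_forall_notMem hr0 hr1 fun t ht hB => h ⟨t, ht, hB⟩
  have hind : Integrable ((E n).indicator (1 : (ℕ → S) → ℝ)) (M.pathLaw π s) :=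
    (integrable_const (1 : ℝ)).indicator (hEm n)
  have h1 := integral_mono (M.integrable_pathReturn π B hr0 hr1 s)
    (hind.add (integrable_const ((n : ℝ) * r))) hbound
  have h2 : ∫ ρ, ((E n).indicator (1 : (ℕ → S) → ℝ) ρ + (n : ℝ) * r) ∂(M.pathLaw π s) =
      M.pr π s (E n) + n * r := by
    rw [integral_add hind (integrable_const _), integral_indicator_one (hEm n)]
    simp [pr]
  have h1 := h1.trans_eq h2
  unfold expReturn
  linarith

end MDP

/-! ### A quantitative maximum principle for finite Markov chains. -/

section Chain

variable {S : Type*} [Fintype S] {p : S → S → ℝ}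

theorem sum_mul_le_of_forall_pos (hp : ∀ s s', 0 ≤ p s s') (hp1 : ∀ s, ∑ s', p s s' = 1)
    {s : S} {f : S → ℝ} {b : ℝ} (h : ∀ s', 0 < p s s' → f s' ≤ b) :
    ∑ s', p s s' * f s' ≤ b := by
  calc ∑ s', p s s' * f s' ≤ ∑ s', p s s' * b := by
        refine Finset.sum_le_sum fun s' _ => ?_
        rcases (hp s s').eq_or_lt with h0 | h0
        · simp [← h0]
        · exact mul_le_mul_of_nonneg_left (h s' h0) h0.le
    _ = b := by rw [← Finset.sum_mul, hp1, one_mul]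

/-- An approximately subharmonic function on a closed set `C` that is smaller by `c` than its upper
bound `b` on `Z` is smaller than `b` by a multiple of `c` in every state from which `Z` is
reachable. -/
theorem exists_le_sub_of_reachable (hp : ∀ s s', 0 ≤ p s s') (hp1 : ∀ s, ∑ s', p s s' = 1)
    {C : Set S} (hC : ∀ s ∈ C, ∀ s', 0 < p s s' → s' ∈ C) (Z : Set S) {s z : S} (hz : z ∈ Z)
    (hsz : Relation.ReflTransGen (fun s s' => 0 < p s s') s z) :
    ∃ (n : ℕ) (κ : ℝ), 0 < κ ∧ (s ∈ C → ∀ (f : S → ℝ) (δ b c : ℝ), 0 ≤ δ →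
      (∀ x ∈ C, f x ≤ ∑ y, p x y * f y + δ) → (∀ x ∈ C, f x ≤ b) →
      (∀ x ∈ C, x ∈ Z → f x ≤ b - c) → f s ≤ b - κ * c + n * δ) := by
  classical
  -- `n` is the length of the path to `Z` and `κ` the product of the transition probabilities along
  -- it; neither depends on `f`, `δ`, `b` or `c`.
  induction hsz using Relation.ReflTransGen.head_induction_on with
  | refl =>
    refine ⟨0, 1, one_pos, fun hs f δ b c _ _ _ h => ?_⟩
    simpa using h z hs hz
  | @head s s' hss' _ ih =>
    obtain ⟨n, κ, hκ, h⟩ := ih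
    refine ⟨n + 1, p s s' * κ, mul_pos hss' hκ, fun hs f δ b c hδ hf hb hZ => ?_⟩
    have h1 := h (hC s hs s' hss') f δ b c hδ hf hb hZ
    have hle : p s s' ≤ 1 := by
      rw [← hp1 s]
      exact Finset.single_le_sum (f := fun s' => p s s') (fun y _ => hp s y) (Finset.mem_univ s')
    have h2 : ∑ y, p s y * f y ≤ ∑ y, p s y * b + p s s' * (-(κ * c) + n * δ) := by
      rw [← Finset.add_sum_erase _ _ (Finset.mem_univ s'),
        ← Finset.add_sum_erase _ (fun y => p s y * b) (Finset.mem_univ s')]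
      have h3 : ∑ y ∈ Finset.univ.erase s', p s y * f y ≤
          ∑ y ∈ Finset.univ.erase s', p s y * b := by
        refine Finset.sum_le_sum fun y _ => ?_
        rcases (hp s y).eq_or_lt with h0 | h0
        · simp [← h0]
        · exact mul_le_mul_of_nonneg_left (hb y (hC s hs y h0)) h0.le
      have h4 := mul_le_mul_of_nonneg_left h1 hss'.le
      linarith
    rw [← Finset.sum_mul, hp1, one_mul] at h2
    have h5 := hf s hs
    have h6 : p s s' * (n * δ) ≤ n * δ := mul_le_of_le_one_left (by positivity) hle
    push_cast
    linarith

/-- At a maximizer the previous estimate reads `b ≤ b - κ * c + n * δ`, so the deficit `c` on `Z` is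
at most `n / κ * δ`. Summing these ratios over all states gives one constant, to be used with `f`
and `δ` varying with `r`. -/
theorem exists_uniform_bound_of_reachable (hp : ∀ s s', 0 ≤ p s s')
    (hp1 : ∀ s, ∑ s', p s s' = 1)
    {C : Set S} (hC : ∀ s ∈ C, ∀ s', 0 < p s s' → s' ∈ C) (Z : Set S)
    (hZ : ∀ s ∈ C, ∃ z ∈ Z, Relation.ReflTransGen (fun s s' => 0 < p s s') s z) :
    ∃ K : ℝ, 0 ≤ K ∧ ∀ (f : S → ℝ) (δ b c : ℝ), 0 ≤ δ →
      (∀ x ∈ C, f x ≤ ∑ y, p x y * f y + δ) → (∀ x ∈ C, f x ≤ b) → (∃ x ∈ C, f x = b) →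
      (∀ x ∈ C, x ∈ Z → f x ≤ b - c) → c ≤ K * δ := by
  have h : ∀ s, ∃ (n : ℕ) (κ : ℝ), 0 < κ ∧ (s ∈ C → ∀ (f : S → ℝ) (δ b c : ℝ), 0 ≤ δ →
      (∀ x ∈ C, f x ≤ ∑ y, p x y * f y + δ) → (∀ x ∈ C, f x ≤ b) →
      (∀ x ∈ C, x ∈ Z → f x ≤ b - c) → f s ≤ b - κ * c + n * δ) := by
    intro s
    by_cases hs : s ∈ C
    · obtain ⟨z, hz, hsz⟩ := hZ s hs
      exact exists_le_sub_of_reachable hp hp1 hC Z hz hsz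
    · exact ⟨0, 1, one_pos, fun h => absurd h hs⟩
  choose n κ hκ h using h
  have hnn : ∀ s, 0 ≤ (n s : ℝ) / κ s := fun s => div_nonneg (Nat.cast_nonneg _) (hκ s).le
  refine ⟨∑ s, n s / κ s, Finset.sum_nonneg fun s _ => hnn s, ?_⟩
  rintro f δ b c hδ hf hb ⟨s, hs, rfl⟩ hc
  have h1 := h s hs f δ (f s) c hδ hf hb hc
  have h2 : c ≤ n s / κ s * δ := by
    rw [div_mul_eq_mul_div, le_div_iff₀ (hκ s)]
    linarith
  refine h2.trans (mul_le_mul_of_nonneg_right ?_ hδ)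
  exact Finset.single_le_sum (f := fun s => (n s : ℝ) / κ s) (fun y _ => hnn y)
    (Finset.mem_univ s)

end Chain

/-! ### Action averages, deterministic policies and the comparison principle. -/

namespace MDP

variable {S A : Type*} [Fintype S]

/-- Disallowed actions have zero rows, so the inequality covers all actions and later estimates need
no membership condition. -/
theorem sum_P_le_one (M : MDP S A) (s : S) (a : A) : ∑ s', M.P s a s' ≤ 1 := by
  by_cases h : a ∈ M.act s
  · exact (M.P_sum_of_mem s a h).le
  · rw [M.P_sum_of_notMem s a h]
    exact zero_le_one

theorem sum_P_mul_le_add (M : MDP S A) (s : S) (a : A) {f g : S → ℝ} {ε : ℝ} (hε : 0 ≤ ε)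
    (h : ∀ s', f s' ≤ g s' + ε) : ∑ s', M.P s a s' * f s' ≤ ∑ s', M.P s a s' * g s' + ε := by
  calc ∑ s', M.P s a s' * f s' ≤ ∑ s', M.P s a s' * (g s' + ε) :=
        Finset.sum_le_sum fun s' _ => mul_le_mul_of_nonneg_left (h s') (M.P_nonneg s a s')
    _ = ∑ s', M.P s a s' * g s' + (∑ s', M.P s a s') * ε := by
        simp only [mul_add, Finset.sum_add_distrib, Finset.sum_mul]
    _ ≤ _ := by
        have := mul_le_mul_of_nonneg_right (M.sum_P_le_one s a) hε
        linarith

theorem bddAbove_range_sum_P_mul (M : MDP S A) (s : S) (a : A) {ι : Type*} {f : ι → S → ℝ}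
    (hf : ∀ i s', f i s' ≤ 1) : BddAbove (Set.range fun i => ∑ s', M.P s a s' * f i s') := by
  refine ⟨1, ?_⟩
  rintro _ ⟨i, rfl⟩
  have := M.sum_P_mul_le_add s a (g := 0) zero_le_one (f := f i) fun s' => by simpa using hf i s'
  simpa using this

variable [Fintype A]

/-- At a minimizer with negative value the average of `w` is no smaller, and a discount below `1`
would raise it strictly above `w` there. -/
theorem nonneg_of_discounted_superharmonic (M : MDP S A) (π : M.Policy) (B : Set S) {r : ℝ}
    (hr0 : 0 < r) (hr1 : r < 1) {w : S → ℝ}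
    (hw : ∀ s, buchiDiscount B r s * ∑ s', M.stepProb π s s' * w s' ≤ w s) (s : S) :
    0 ≤ w s := by
  obtain ⟨x, -, hmin⟩ := Set.exists_min_image Set.univ w Set.finite_univ ⟨s, Set.mem_univ s⟩
  have hx : 0 ≤ w x := by
    by_contra! hneg
    have h1 : w x ≤ ∑ s', M.stepProb π x s' * w s' := by
      have := sum_mul_le_of_forall_pos (M.stepProb_nonneg π) (M.stepProb_sum π) (s := x)
        (f := fun s' => - w s') (b := - w x) fun s' _ => neg_le_neg (hmin s' (Set.mem_univ s'))
      simp only [mul_neg, Finset.sum_neg_distrib] at this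
      linarith
    have h2 := mul_le_mul_of_nonneg_left h1 (buchiDiscount_nonneg (B := B) hr0 hr1 x)
    have h3 := hw x
    nlinarith [buchiDiscount_lt_one (B := B) hr0 x]
  exact hx.trans (hmin s (Set.mem_univ s))

/-- The choices of one allowed action in each state. -/
abbrev Selector (M : MDP S A) : Type _ := {d : S → A // ∀ s, d s ∈ M.act s}

instance (M : MDP S A) : Nonempty M.Selector :=
  ⟨⟨fun s => (M.act_nonempty s).some, fun s => (M.act_nonempty s).some_mem⟩⟩

open Classical in
/-- The deterministic policy that plays a selector. -/
noncomputable def Selector.policy {M : MDP S A} (d : M.Selector) : M.Policy where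
  prob s a := if a = d.1 s then 1 else 0
  prob_nonneg s a := by split_ifs <;> norm_num
  prob_sum s := by simp
  prob_eq_zero s a ha := if_neg (by rintro rfl; exact ha (d.2 s))

instance (M : MDP S A) : Nonempty M.Policy :=
  ⟨(Classical.arbitrary M.Selector).policy⟩

theorem Selector.stepProb_policy {M : MDP S A} (d : M.Selector) (s s' : S) :
    M.stepProb d.policy s s' = M.P s (d.1 s) s' := by
  unfold stepProb
  rw [Finset.sum_eq_single (d.1 s) (fun a _ ha => by simp [Selector.policy, ha]) (by simp)]
  simp [Selector.policy]

/-! ### Reachability of the Büchi set and the lower bound on the return. -/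

variable [MeasurableSpace S] [DiscreteMeasurableSpace S]

/-- The state `s'` is reachable from `s` in the chain induced by `π`. -/
def Reaches (M : MDP S A) (π : M.Policy) : S → S → Prop :=
  Relation.ReflTransGen fun s s' => 0 < M.stepProb π s s'

/-- First-step analysis makes each event `ρ t ∈ B` null, and countably many null events cover `□ ◇
B`. -/
theorem pr_alwaysEventually_eq_zero (M : MDP S A) (π : M.Policy) (B : Set S) {s : S}
    (hs : ∀ z ∈ B, ¬ M.Reaches π s z) : M.pr π s (alwaysEventually B) = 0 := by
  have key : ∀ (t : ℕ) (s : S), (∀ z ∈ B, ¬ M.Reaches π s z) →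
      M.pr π s {ρ | ρ t ∈ B} = 0 := by
    intro t
    have hm : MeasurableSet {ρ : ℕ → S | ρ t ∈ B} :=
      measurable_pi_apply (X := fun _ => S) t (.of_discrete (s := B))
    induction t with
    | zero =>
      intro s hs
      rw [M.pr_eq_sum π s hm]
      have : pathCons s ⁻¹' {ρ : ℕ → S | ρ 0 ∈ B} = ∅ := by
        ext ρ
        simp only [Set.mem_preimage, Set.mem_ofPred_eq, pathCons_zero, Set.mem_empty_iff_false,
          iff_false]
        exact fun h => hs s h .refl
      simp [this, pr]
    | succ t ih =>
      intro s hs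
      rw [M.pr_eq_sum π s hm]
      refine Finset.sum_eq_zero fun s' _ => ?_
      rcases (M.stepProb_nonneg π s s').eq_or_lt with h0 | h0
      · simp [← h0]
      · have := ih (measurable_pi_apply (X := fun _ => S) t (.of_discrete (s := B))) s'
          fun z hz h => hs z hz (.head h0 h)
        exact mul_eq_zero_of_right _ this
  have hsub : alwaysEventually B ⊆ ⋃ t, {ρ : ℕ → S | ρ t ∈ B} := by
    intro ρ hρ
    obtain ⟨t, -, ht⟩ := hρ 0
    exact Set.mem_iUnion.2 ⟨t, ht⟩
  have hnull : M.pathLaw π s (alwaysEventually B) = 0 :=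
    measure_mono_null hsub (measure_iUnion_null fun t =>
      (measureReal_eq_zero_iff (measure_ne_top _ _)).1 (key t s hs))
  simp [pr, measureReal_def, hnull]

/-- Where the Büchi set always remains reachable, the expected return is close to `1`. -/
theorem exists_one_sub_expReturn_le (M : MDP S A) (π : M.Policy) (B : Set S) :
    ∃ K : ℝ, 0 ≤ K ∧ ∀ r : ℝ, 0 < r → r < 1 →
      ∀ s, (∀ s', M.Reaches π s s' → ∃ z ∈ B, M.Reaches π s' z) →
        1 - M.expReturn (buchiReward B r) (buchiDiscount B r) π s ≤ K * r := by
  set C : Set S := {s | ∀ s', M.Reaches π s s' → ∃ z ∈ B, M.Reaches π s' z} with hCdef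
  have hC : ∀ s ∈ C, ∀ s', 0 < M.stepProb π s s' → s' ∈ C :=
    fun s hs s' hss' s'' h => hs s'' (.head hss' h)
  obtain ⟨K, hK, hbound⟩ := exists_uniform_bound_of_reachable (M.stepProb_nonneg π)
    (M.stepProb_sum π) hC B fun s hs => hs s .refl
  refine ⟨K + 1, by linarith, fun r hr0 hr1 s hs => ?_⟩
  set g : S → ℝ := fun s => 1 - M.expReturn (buchiReward B r) (buchiDiscount B r) π s with hg
  have hg0 : ∀ s, 0 ≤ g s := fun s => sub_nonneg.2 (M.expReturn_le_one π B hr0 hr1 s)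
  have hgeq : ∀ s, g s = r ^ 2 + buchiDiscount B r s * ∑ s', M.stepProb π s s' * g s' := by
    intro s
    have h1 := M.expReturn_eq π B hr0 hr1 s
    have h2 := buchiDiscount_mul_add (B := B) (r := r) s
    simp only [hg, mul_sub, mul_one, Finset.sum_sub_distrib, M.stepProb_sum]
    linarith
  obtain ⟨x, hx, hmax⟩ := Set.exists_max_image C g (Set.toFinite C) ⟨s, hs⟩
  have hPg : ∀ y ∈ C, ∑ s', M.stepProb π y s' * g s' ≤ g x := fun y hy =>
    sum_mul_le_of_forall_pos (M.stepProb_nonneg π) (M.stepProb_sum π)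
      fun s' h => hmax s' (hC y hy s' h)
  have hPg0 : ∀ y, 0 ≤ ∑ s', M.stepProb π y s' * g s' := fun y =>
    Finset.sum_nonneg fun s' _ => mul_nonneg (M.stepProb_nonneg π y s') (hg0 s')
  -- The loss `g` is subharmonic up to `r ^ 2`, and on `B` the discount gives `g ≤ r ^ 2 + (1 - r) *
  -- max g`, a deficit of `r * max g - r ^ 2`. The principle bounds it by `K * r ^ 2`; dividing by
  -- `r` leaves a loss of order `r`. Here it matters that the discount outside `B` is `1 - r ^ 2`.
  have h := hbound g (r ^ 2) (g x) (r * g x - r ^ 2) (sq_nonneg r) (fun y _ => by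
      have := hgeq y
      have := mul_le_of_le_one_left (hPg0 y) (buchiDiscount_lt_one (B := B) hr0 y).le
      linarith) hmax ⟨x, hx, rfl⟩ (fun y hy hyB => by
      have h1 := hgeq y
      have h2 : buchiDiscount B r y = 1 - r := if_pos hyB
      rw [h2] at h1
      have h3 := mul_le_mul_of_nonneg_left (hPg y hy) (sub_nonneg.2 hr1.le)
      linarith)
  have h1 : g x ≤ (K + 1) * r := by
    have : r * g x ≤ r * ((K + 1) * r) := by nlinarith
    exact le_of_mul_le_mul_left this hr0
  exact (hmax s hs).trans h1

/-- The expected return is asymptotically at least the probability of the Büchi condition. -/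
theorem exists_pr_le_expReturn_add (M : MDP S A) (π : M.Policy) (B : Set S) :
    ∃ K : ℝ, ∀ r : ℝ, 0 < r → r < 1 → ∀ s, M.pr π s (alwaysEventually B) ≤
      M.expReturn (buchiReward B r) (buchiDiscount B r) π s + K * r := by
  obtain ⟨K₁, hK₁, h₁⟩ := M.exists_one_sub_expReturn_le π B
  -- On `Z` the claim is known: in the first case the return is within `K₁ * r` of `1`, in the
  -- second the Büchi probability is `0`. Every state reaches `Z`.
  set Z : Set S := {s | (∀ s', M.Reaches π s s' → ∃ z ∈ B, M.Reaches π s' z) ∨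
    ∀ z ∈ B, ¬ M.Reaches π s z} with hZdef
  have hZ : ∀ s ∈ (Set.univ : Set S), ∃ z ∈ Z, M.Reaches π s z := by
    intro s _
    by_cases hs : ∀ s', M.Reaches π s s' → ∃ z ∈ B, M.Reaches π s' z
    · exact ⟨s, Or.inl hs, .refl⟩
    · push Not at hs
      obtain ⟨s', hss', h⟩ := hs
      exact ⟨s', Or.inr h, hss'⟩
  obtain ⟨K, hK, hbound⟩ := exists_uniform_bound_of_reachable (M.stepProb_nonneg π)
    (M.stepProb_sum π) (fun _ _ _ _ => Set.mem_univ _) Z hZ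
  refine ⟨K + K₁, fun r hr0 hr1 s => ?_⟩
  set u : S → ℝ := fun s => M.pr π s (alwaysEventually B) with hu
  set h : S → ℝ := M.expReturn (buchiReward B r) (buchiDiscount B r) π with hh
  obtain ⟨x, hx, hmax⟩ := Set.exists_max_image Set.univ (fun s => u s - h s) Set.finite_univ
    ⟨s, Set.mem_univ s⟩
  -- The Büchi probability is harmonic and the return loses at most `r` per step, so `u - h` is
  -- subharmonic up to `δ = r`; on `Z` it is at most `K₁ * r`.
  have hfin := hbound (fun s => u s - h s) r (u x - h x) (u x - h x - K₁ * r) hr0.le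
    (fun y _ => by
      have e1 : u y = ∑ s', M.stepProb π y s' * u s' := M.pr_alwaysEventually π B y
      have e2 := M.expReturn_eq π B hr0 hr1 y
      have e3 := buchiReward_nonneg (B := B) hr0 y
      have e4 := le_buchiDiscount (B := B) hr0 hr1 y
      have e5 : 0 ≤ ∑ s', M.stepProb π y s' * h s' := Finset.sum_nonneg fun s' _ =>
        mul_nonneg (M.stepProb_nonneg π y s') (M.expReturn_nonneg π B hr0 hr1 s')
      have e6 : ∑ s', M.stepProb π y s' * h s' ≤ 1 :=
        sum_mul_le_of_forall_pos (M.stepProb_nonneg π) (M.stepProb_sum π)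
          fun s' _ => M.expReturn_le_one π B hr0 hr1 s'
      have e7 : (1 - r) * ∑ s', M.stepProb π y s' * h s' ≤ h y :=
        (mul_le_mul e4 (le_add_of_nonneg_left e3) e5
          (buchiDiscount_nonneg hr0 hr1 y)).trans_eq e2.symm
      simp only [mul_sub, Finset.sum_sub_distrib]
      have e8 := mul_le_mul_of_nonneg_left e6 hr0.le
      linarith) hmax ⟨x, hx, rfl⟩
    (fun y _ hy => by
      have e1 : 0 ≤ K₁ * r := mul_nonneg hK₁ hr0.le
      have e2 : u y ≤ 1 := M.pr_le_one π y _
      have e3 : 0 ≤ h y := M.expReturn_nonneg π B hr0 hr1 y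
      rcases hy with hy | hy
      · have : 1 - h y ≤ K₁ * r := h₁ r hr0 hr1 y hy
        linarith
      · have : u y = 0 := M.pr_alwaysEventually_eq_zero π B hy
        linarith)
  have hs : u s - h s ≤ u x - h x := hmax s (Set.mem_univ s)
  change u s ≤ h s + (K + K₁) * r
  linarith

/-! ### Optimality of deterministic policies for the return. -/

variable {r : ℝ}

/-- Subtracting the Bellman equation of the policy cancels the reward and leaves a discounted
superharmonic difference. -/
theorem expReturn_le_of_bellman_le (M : MDP S A) (π : M.Policy) (B : Set S) (hr0 : 0 < r)
    (hr1 : r < 1) {v : S → ℝ} (hv : ∀ s, buchiDiscount B r s *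
      (buchiReward B r s + ∑ s', M.stepProb π s s' * v s') ≤ v s) (s : S) :
    M.expReturn (buchiReward B r) (buchiDiscount B r) π s ≤ v s := by
  refine sub_nonneg.1 (M.nonneg_of_discounted_superharmonic π B hr0 hr1
    (w := fun s => v s - M.expReturn (buchiReward B r) (buchiDiscount B r) π s) (fun s => ?_) s)
  have h1 := hv s
  have h2 := M.expReturn_eq π B hr0 hr1 s
  simp only [mul_sub, Finset.sum_sub_distrib]
  linarith

theorem le_expReturn_of_le_bellman (M : MDP S A) (π : M.Policy) (B : Set S) (hr0 : 0 < r)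
    (hr1 : r < 1) {v : S → ℝ} (hv : ∀ s, v s ≤ buchiDiscount B r s *
      (buchiReward B r s + ∑ s', M.stepProb π s s' * v s')) (s : S) :
    v s ≤ M.expReturn (buchiReward B r) (buchiDiscount B r) π s := by
  refine sub_nonneg.1 (M.nonneg_of_discounted_superharmonic π B hr0 hr1
    (w := fun s => M.expReturn (buchiReward B r) (buchiDiscount B r) π s - v s) (fun s => ?_) s)
  have h1 := hv s
  have h2 := M.expReturn_eq π B hr0 hr1 s
  simp only [mul_sub, Finset.sum_sub_distrib]
  linarith

/-- Some deterministic memoryless policy maximizes the expected return in all states. -/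
theorem exists_optimal_selector (M : MDP S A) (B : Set S) (hr0 : 0 < r) (hr1 : r < 1) :
    ∃ d : M.Selector, ∀ (π : M.Policy) (s : S),
      M.expReturn (buchiReward B r) (buchiDiscount B r) π s ≤
        M.expReturn (buchiReward B r) (buchiDiscount B r) d.policy s := by
  classical
  set h : M.Selector → S → ℝ := fun d =>
    M.expReturn (buchiReward B r) (buchiDiscount B r) d.policy with hh
  obtain ⟨d, hd⟩ := Finite.exists_max fun d : M.Selector => ∑ s, h d s
  have hΓ := fun s => buchiDiscount_nonneg (B := B) hr0 hr1 s
  have heq : ∀ (d : M.Selector) (s : S), h d s = buchiDiscount B r s *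
      (buchiReward B r s + ∑ s', M.P s (d.1 s) s' * h d s') := by
    intro d s
    simp only [hh]
    rw [M.expReturn_eq d.policy B hr0 hr1 s]
    simp only [Selector.stepProb_policy]
  -- `d` maximizes the sum of the returns over all states. If an action improved on it at `s`,
  -- switching at `s` alone would lower no return and raise the one at `s`, hence raise the sum.
  have hopt : ∀ s, ∀ a ∈ M.act s, buchiDiscount B r s *
      (buchiReward B r s + ∑ s', M.P s a s' * h d s') ≤ h d s := by
    intro s a ha
    by_contra! hlt
    let d' : M.Selector := ⟨Function.update d.1 s a, fun x => by
      by_cases hx : x = s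
      · subst hx; simpa using ha
      · simpa [hx] using d.2 x⟩
    have hds : d'.1 s = a := Function.update_self s a d.1
    have hle : ∀ x, h d x ≤ h d' x := by
      refine M.le_expReturn_of_le_bellman d'.policy B hr0 hr1 fun x => ?_
      simp only [Selector.stepProb_policy]
      by_cases hx : x = s
      · subst hx
        rw [hds]
        exact hlt.le
      · have : d'.1 x = d.1 x := Function.update_of_ne hx a d.1
        rw [this]
        exact (heq d x).le
    have hlt' : h d s < h d' s := by
      refine hlt.trans_le ?_
      rw [heq d' s, hds]
      refine mul_le_mul_of_nonneg_left ?_ (hΓ s)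
      gcongr with s' _
      · exact M.P_nonneg s a s'
      · exact hle s'
    exact absurd (hd d') (not_le.2
      (Finset.sum_lt_sum (fun x _ => hle x) ⟨s, Finset.mem_univ s, hlt'⟩))
  refine ⟨d, fun π => M.expReturn_le_of_bellman_le π B hr0 hr1 fun s => ?_⟩
  -- The Bellman operator of a mixed policy is the average of those of its actions, so mixing gains
  -- nothing over `d`.
  have hexp : buchiDiscount B r s * (buchiReward B r s + ∑ s', M.stepProb π s s' * h d s') =
      ∑ a, π.prob s a * (buchiDiscount B r s *
        (buchiReward B r s + ∑ s', M.P s a s' * h d s')) := by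
    have h1 : ∑ s', M.stepProb π s s' * h d s' =
        ∑ a, π.prob s a * ∑ s', M.P s a s' * h d s' := by
      simp only [stepProb, Finset.sum_mul, Finset.mul_sum]
      rw [Finset.sum_comm]
      exact Finset.sum_congr rfl fun a _ => Finset.sum_congr rfl fun s' _ => by ring
    rw [h1]
    have h2 := π.prob_sum s
    calc _ = buchiDiscount B r s * (buchiReward B r s * ∑ a, π.prob s a +
          ∑ a, π.prob s a * ∑ s', M.P s a s' * h d s') := by rw [h2, mul_one]
      _ = _ := by
        rw [Finset.mul_sum, ← Finset.sum_add_distrib, Finset.mul_sum]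
        exact Finset.sum_congr rfl fun a _ => by ring
  change buchiDiscount B r s * (buchiReward B r s + ∑ s', M.stepProb π s s' * h d s') ≤ h d s
  rw [hexp]
  calc _ ≤ ∑ a, π.prob s a * h d s := by
        refine Finset.sum_le_sum fun a _ => ?_
        by_cases ha : a ∈ M.act s
        · exact mul_le_mul_of_nonneg_left (hopt s a ha) (π.prob_nonneg s a)
        · simp [π.prob_eq_zero s a ha]
    _ = h d s := by rw [← Finset.sum_mul, π.prob_sum, one_mul]

/-! ### The limit of small `r` and the separation of actions. -/

theorem prAct_le_prMax (M : MDP S A) (π : M.Policy) (s : S) (a : A) (φ : Set (ℕ → S)) :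
    M.prAct π s a φ ≤ M.prMax s a φ :=
  le_ciSup (f := fun π => M.prAct π s a φ)
    (M.bddAbove_range_sum_P_mul s a fun π s' => M.pr_le_one π s' φ) π

theorem le_qMax (M : MDP S A) (π : M.Policy) (B : Set S) (hr0 : 0 < r) (hr1 : r < 1) (s : S)
    (a : A) : ∑ s', M.P s a s' * M.expReturn (buchiReward B r) (buchiDiscount B r) π s' ≤
      M.qMax (buchiReward B r) (buchiDiscount B r) s a :=
  le_ciSup (f := fun π => ∑ s', M.P s a s' *
    M.expReturn (buchiReward B r) (buchiDiscount B r) π s')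
    (M.bddAbove_range_sum_P_mul s a fun π s' => M.expReturn_le_one π B hr0 hr1 s') π

/-- As `r` tends to `0`, the maximum expected return tends to the maximum probability of the Büchi
condition. -/
theorem tendsto_qMax (M : MDP S A) (B : Set S) (s : S) (a : A) :
    Tendsto (fun r => M.qMax (buchiReward B r) (buchiDiscount B r) s a) (𝓝[>] 0)
      (𝓝 (M.prMax s a (alwaysEventually B))) := by
  have hunit : Set.Ioo (0 : ℝ) 1 ∈ 𝓝[>] (0 : ℝ) := Ioo_mem_nhdsGT zero_lt_one
  refine tendsto_order.2 ⟨fun c hc => ?_, fun c hc => ?_⟩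
  -- From below, a single policy with probability above `c` suffices.
  · obtain ⟨π, hπ⟩ := exists_lt_of_lt_ciSup hc
    obtain ⟨K, hK⟩ := M.exists_pr_le_expReturn_add π B
    have hlim : Tendsto (fun r : ℝ => |K| * r) (𝓝[>] 0) (𝓝 (|K| * 0)) :=
      ((continuous_const.mul continuous_id).tendsto 0).mono_left nhdsWithin_le_nhds
    filter_upwards [hunit, hlim.eventually_lt_const
      (show |K| * 0 < M.prAct π s a (alwaysEventually B) - c by linarith)] with r ⟨hr0, hr1⟩ hr
    have h1 := M.sum_P_mul_le_add s a (mul_nonneg (abs_nonneg K) hr0.le) fun s' =>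
      (hK r hr0 hr1 s').trans
        (add_le_add_right (mul_le_mul_of_nonneg_right (le_abs_self K) hr0.le) _)
    have h2 := M.le_qMax π B hr0 hr1 s a
    unfold prAct at hr
    linarith
  · set ε := (c - M.prMax s a (alwaysEventually B)) / 2 with hε
    have hε0 : 0 < ε := by linarith
    -- The optimal selector may change with `r`, so the estimate is taken for all of the finitely
    -- many selectors at once.
    have hall : ∀ᶠ r in 𝓝[>] (0 : ℝ), ∀ (d : M.Selector) (s' : S),
        M.expReturn (buchiReward B r) (buchiDiscount B r) d.policy s' ≤
          M.pr d.policy s' (alwaysEventually B) + ε :=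
      eventually_all.2 fun d => eventually_all.2 fun s' =>
        M.eventually_expReturn_le d.policy B s' hε0
    filter_upwards [hunit, hall] with r ⟨hr0, hr1⟩ hr
    obtain ⟨d, hd⟩ := M.exists_optimal_selector B hr0 hr1
    have hq : M.qMax (buchiReward B r) (buchiDiscount B r) s a ≤
        M.prMax s a (alwaysEventually B) + ε := by
      refine ciSup_le fun π => ?_
      have h1 := M.sum_P_mul_le_add s a hε0.le fun s' => (hd π s').trans (hr d s')
      have h2 := M.prAct_le_prMax d.policy s a (alwaysEventually B)
      unfold prAct at h2
      linarith
    linarith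

theorem vMax_sub_qMax_le_iff (M : MDP S A) (R Γ : S → ℝ) (s : S) (a : A) (τ : ℝ) :
    M.vMax R Γ s - M.qMax R Γ s a ≤ τ ↔
      ∀ b ∈ M.act s, M.qMax R Γ s b - M.qMax R Γ s a ≤ τ := by
  have : Nonempty (M.act s) := (M.act_nonempty s).to_subtype
  have h := ciSup_le_iff (f := fun b : M.act s => M.qMax R Γ s b) (a := τ + M.qMax R Γ s a)
    (Set.finite_range _).bddAbove
  rw [sub_le_iff_le_add, vMax, h]
  simp

/-- For a small tolerance `τ` and a small `r`, the actions with an almost maximum expected return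
are those with the maximum probability of the Büchi condition. -/
theorem exists_optAct_alwaysEventually_eq (M : MDP S A) (B : Set S) :
    ∃ τ₀ : ℝ, 0 < τ₀ ∧ ∀ τ : ℝ, 0 < τ → τ < τ₀ →
      ∃ r₀ : ℝ, 0 < r₀ ∧ ∀ r : ℝ, 0 < r → r < r₀ → ∀ s,
        M.optAct (alwaysEventually B) s =
          {a | a ∈ M.act s ∧ M.vMax (buchiReward B r) (buchiDiscount B r) s -
            M.qMax (buchiReward B r) (buchiDiscount B r) s a ≤ τ} := by
  set P : S → A → ℝ := fun s a => M.prMax s a (alwaysEventually B) with hP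
  have hgap : ∀ᶠ τ in 𝓝[>] (0 : ℝ), ∀ s a b, P s a < P s b → τ < P s b - P s a := by
    refine eventually_all.2 fun s => eventually_all.2 fun a => eventually_all.2 fun b => ?_
    by_cases h : P s a < P s b
    · filter_upwards [Ioo_mem_nhdsGT (sub_pos.2 h)] with τ hτ _
      exact hτ.2
    · exact .of_forall fun τ h' => absurd h' h
  obtain ⟨τ₀, hτ₀, hsub⟩ := mem_nhdsGT_iff_exists_Ioo_subset.1 hgap
  refine ⟨τ₀, hτ₀, fun τ hτ0 hτ => ?_⟩
  have hτgap : ∀ s a b, P s a < P s b → τ < P s b - P s a := hsub ⟨hτ0, hτ⟩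
  -- With `τ` fixed, the difference of returns tends to a limit that is either at most `0 < τ` or,
  -- by the gap, larger than `τ`; for small `r` it lies on the same side.
  have hev : ∀ᶠ r in 𝓝[>] (0 : ℝ), ∀ s a b, P s b ≤ P s a ↔
      M.qMax (buchiReward B r) (buchiDiscount B r) s b -
        M.qMax (buchiReward B r) (buchiDiscount B r) s a ≤ τ := by
    refine eventually_all.2 fun s => eventually_all.2 fun a => eventually_all.2 fun b => ?_
    have hlim := (M.tendsto_qMax B s b).sub (M.tendsto_qMax B s a)
    rcases le_or_gt (P s b) (P s a) with h | h
    · filter_upwards [hlim.eventually_lt_const (show P s b - P s a < τ by linarith)] with r hr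
      exact ⟨fun _ => hr.le, fun _ => h⟩
    · filter_upwards [hlim.eventually_const_lt (hτgap s a b h)] with r hr
      exact ⟨fun h' => absurd h' (not_le.2 h), fun h' => absurd h' (not_le.2 hr)⟩
  obtain ⟨r₀, hr₀, hsub'⟩ := mem_nhdsGT_iff_exists_Ioo_subset.1 hev
  refine ⟨r₀, hr₀, fun r hr0 hr s => ?_⟩
  have h : ∀ s a b, P s b ≤ P s a ↔
      M.qMax (buchiReward B r) (buchiDiscount B r) s b -
        M.qMax (buchiReward B r) (buchiDiscount B r) s a ≤ τ := hsub' ⟨hr0, hr⟩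
  ext a
  simp only [optAct, Set.mem_ofPred_eq, vMax_sub_qMax_le_iff, ← h]
  rfl

end MDP

theorem lemma3 {S A AP Qψ Qφ : Type*} [Fintype S] [Fintype A] [Finite AP] [Fintype Qψ] [Fintype Qφ]
    [MeasurableSpace S] [DiscreteMeasurableSpace S]
    [MeasurableSpace Qψ] [DiscreteMeasurableSpace Qψ]
    [MeasurableSpace Qφ] [DiscreteMeasurableSpace Qφ]
    (M : LabeledMDP S A AP) (Aψ : SafetyAutomaton Qψ AP) (Aφ : LDBA Qφ AP) :
    ∃ τ₀ : ℝ, 0 < τ₀ ∧ ∀ τ : ℝ, 0 < τ → τ < τ₀ →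
      ∃ r₀ : ℝ, 0 < r₀ ∧ ∀ r : ℝ, 0 < r → r < r₀ →
        ∀ s : S × Qψ × Qφ,
          buchiAct M Aψ Aφ s =
            {a | a ∈ safeAct M Aψ Aφ s ∧
              (prunedMDP M Aψ Aφ).vMax (buchiReward (prodBφ S Qψ Aφ) r)
                  (buchiDiscount (prodBφ S Qψ Aφ) r) s -
                (prunedMDP M Aψ Aφ).qMax (buchiReward (prodBφ S Qψ Aφ) r)
                  (buchiDiscount (prodBφ S Qψ Aφ) r) s a ≤ τ} :=
  -- By definition `safeAct` gives the allowed actions of the pruned MDP and `buchiAct` is its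
  -- `optAct`.
  (prunedMDP M Aψ Aφ).exists_optAct_alwaysEventually_eq (prodBφ S Qψ Aφ)
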